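/- Let $\alpha>-1$. For real $z$ put $\binom zk=\frac{z(z-1)\cdots(z-k+1)}{k!}$ if $k\ge 0$ is an integer, and $\binom zk=0$ if $k<0$; let $(z)_k=z(z+1)\cdots(z+k-1)$ and $D=\frac{d}{dx}$. For all real $\mu,\nu$ and $n=0,1,2,\dots$ let $$P_n^{(\mu,\nu)}(x)=\sum_{k=0}^n\frac{(n+\mu+\nu+1)_k(\mu+k+1)_{n-k}}{k!\,(n-k)!}\Bigl(\frac{x-1}2\Bigr)^k$$ be the classical Jacobi polynomials, and for $M\ge 0$ let $$P_n^{\alpha,\alpha,M,M}(x)=C_0P_n^{(\alpha,\alpha)}(x)-C_1\,x\,DP_n^{(\alpha,\alpha)}(x),\qquad n=0,1,2,\dots,$$ $$C_0=1+\frac{2Mn}{\alpha+1}\binom{n+2\alpha+1}{n}+4M^2\binom{n+2\alpha+1}{n-1}^2,\qquad C_1=\frac{2M}{2\alpha+1}\binom{n+2\alpha}{n}+\frac{2M^2}{\alpha+1}\binom{n+2\alpha}{n-1}\binom{n+2\alpha+1}{n}$$ be the symmetric generalized ultraspherical polynomials. Here and below $\frac1{2\alpha+1}\binom{n+2\alpha}{n}$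 is understood by continuity if $\alpha=-\frac12$ and $n\ge1$, that is, as $\frac1n$; for $n=0$ it is only multiplied by derivatives of a constant, and these products are $0$. Let $a_0(n)$, $n=0,1,2,\dots$, be real numbers and let $a_i:\mathbb R\to\mathbb R$, $i=1,2,3,\dots$, be functions. Neither the numbers $a_0(n)$ nor the functions $a_i$ depend on $M$, and the functions $a_i$ do not depend on $n$. Put $a_0(x):=a_0(n)$ in the $n$-th equation of each family below. The following three statements are equivalent. 1. The functions $a_i$, $i\ge1$, are continuous, and for all $M\ge0$ and all $n=0,1,2,\dots$ the polynomial $y=P_n^{\alpha,\alpha,M,M}$ satisfies, for all real $x$, $$M\sum_{i=0}^\infty a_i(x)y^{(i)}(x)+(1-x^2)y''(x)-2(\alpha+1)xy'(x)+n(n+2\alpha+1)y(x)=0.$$ 2. The functions $a_i$, $i\ge1$, are continuous, and for all $n=0,1,2,\dots$ and all real $x$ $$\sum_{i=0}^\infty a_i(x)D^iP_n^{(\alpha,\alpha)}(x)=\frac4{2\alpha+1}\binom{n+2\alpha}nD^2P_n^{(\alpha,\alpha)}(x)$$ and $$\sum_{i=0}^\infty i\,a_i(x)D^iP_n^{(\alpha,\alpha)}(x)+x\sum_{i=0}^\infty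 a_i(x)D^{i+1}P_n^{(\alpha,\alpha)}(x)=4\binom{n+2\alpha+1}{n-1}D^2P_n^{(\alpha,\alpha)}(x).$$ 3. For all $n=0,1,2,\dots$, all $i=1,2,3,\dots$ and all real $x$ $$a_0(n)=a_0(1)\,b_0(n)+c_0(n),\qquad a_i(x)=a_0(1)\,b_i(x)+c_i(x),$$ where $$b_0(n)=\tfrac12\bigl[1-(-1)^n\bigr],\qquad c_0(n)=4(2\alpha+3)\binom{n+2\alpha+2}{n-2},$$ $$b_i(x)=\frac{2^{i-1}}{i!}(-x)^i\quad(i\ge1),\qquad c_1(x)=0,\qquad c_i(x)=(2\alpha+3)(1-x^2)\frac{2^i}{i!}P_{i-2}^{(\alpha-i+3,\,\alpha-i+3)}(x)\quad(i\ge2).$$ Moreover $a_0(1)$ is arbitrary: for every real $t$ there are coefficients with $a_0(1)=t$ that satisfy statement 1. -/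

import Mathlib

open Polynomial

noncomputable section

namespace GenUltraspherical

/-- The binomial coefficient `z (z - 1) ⋯ (z - k + 1) / k!` for real `z` and an integer `k ≥ 0`;
it is zero for `k < 0`. -/
def binom (z : ℝ) (k : ℤ) : ℝ :=
  if 0 ≤ k then Ring.choose z k.toNat else 0

/-- The quotient `binom (n + 2 α) n / (2 α + 1)`. Its singularity at `α = -1/2` is removable for
`n ≥ 1`, and the value there is the limit `1 / n` (see `binomQuot_eq`). For `n = 0` and `α = -1/2`
the value is irrelevant, since the quotient is only used as a factor of derivatives of a
polynomial of degree `n`. -/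
def binomQuot (α : ℝ) (n : ℕ) : ℝ :=
  if 2 * α + 1 = 0 then 1 / n else 1 / (2 * α + 1) * binom (n + 2 * α) n

/-- For `n ≥ 1` the quotient `binomQuot α n` is a polynomial in `α`. In particular
it is continuous at `α = -1/2`. -/
theorem binomQuot_eq (α : ℝ) (n : ℕ) (hn : 1 ≤ n) :
    binomQuot α n = binom (n + 2 * α) ((n : ℤ) - 1) / n := by
  obtain ⟨m, rfl⟩ : ∃ m, n = m + 1 := ⟨n - 1, by omega⟩
  have hm : ((m : ℝ) + 1) ≠ 0 := by positivity
  have e : ((m + 1 : ℕ) : ℤ) - 1 = (m : ℤ) := by push_cast; ring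
  unfold binomQuot binom
  rw [e]
  simp only [Nat.cast_nonneg, if_true, Int.toNat_natCast]
  split_ifs with h
  · have h2 : ((m + 1 : ℕ) : ℝ) + 2 * α = (m : ℝ) := by push_cast; linarith
    rw [h2, Ring.choose_natCast, Nat.choose_self]
    simp
  · rw [Ring.choose_eq_smul, Ring.choose_eq_smul, descPochhammer_succ_right,
      Polynomial.smeval_mul, Nat.factorial_succ]
    have h3 : (X - (m : ℤ[X])).smeval (((m + 1 : ℕ) : ℝ) + 2 * α) = 2 * α + 1 := by
      rw [Polynomial.smeval_sub, Polynomial.smeval_X, Polynomial.smeval_natCast]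
      simp
      ring
    rw [h3]
    have hf : ((m.factorial : ℕ) : ℝ) ≠ 0 := by positivity
    simp only [smul_eq_mul]
    push_cast
    field_simp

/-- The classical Jacobi polynomial `P_n^{(α, β)}`, for arbitrary real parameters. -/
def jacobi (n : ℕ) (α β : ℝ) : ℝ[X] :=
  ∑ k ∈ Finset.range (n + 1),
    C ((ascPochhammer ℝ k).eval (n + α + β + 1) * (ascPochhammer ℝ (n - k)).eval (α + k + 1) /
        (k.factorial * (n - k).factorial)) *
      (C (1 / 2) * (X - 1)) ^ k

/-- The constant `C₀` of the symmetric generalized ultraspherical polynomials. -/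
def constC0 (α M : ℝ) (n : ℕ) : ℝ :=
  1 + 2 * M * n / (α + 1) * binom (n + 2 * α + 1) n
    + 4 * M ^ 2 * binom (n + 2 * α + 1) ((n : ℤ) - 1) ^ 2

/-- The constant `C₁` of the symmetric generalized ultraspherical polynomials. -/
def constC1 (α M : ℝ) (n : ℕ) : ℝ :=
  2 * M * binomQuot α n
    + 2 * M ^ 2 / (α + 1) * binom (n + 2 * α) ((n : ℤ) - 1) * binom (n + 2 * α + 1) n

/-- The symmetric generalized ultraspherical polynomial
`P_n^{α,α,M,M} = C₀ P_n^{(α,α)} - C₁ x D P_n^{(α,α)}`. -/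
def genUltraspherical (n : ℕ) (α M : ℝ) : ℝ[X] :=
  C (constC0 α M n) * jacobi n α α
    - C (constC1 α M n) * (X * derivative (jacobi n α α))

/-- The coefficients of an operator of infinite order: the zeroth one is the constant `c`, the
`i`-th one is the function `a i` for `i ≥ 1` (the entry `a 0` is not used). -/
def opCoeff (c : ℝ) (a : ℕ → ℝ → ℝ) : ℕ → ℝ → ℝ
  | 0, _ => c
  | i + 1, x => a (i + 1) x

/-- The differential equation
`M ∑ aᵢ(x) y⁽ⁱ⁾(x) + (1 - x²) y''(x) - 2 (α + 1) x y'(x) + n (n + 2 α + 1) y(x) = 0`, where the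
zeroth coefficient is the constant `c`, for a polynomial `y` (so that the series has only
finitely many nonzero terms). -/
def SatisfiesDE (α M : ℝ) (n : ℕ) (c : ℝ) (a : ℕ → ℝ → ℝ) (y : ℝ[X]) : Prop :=
  ∀ x : ℝ,
    M * (∑' i : ℕ, opCoeff c a i x * (derivative^[i] y).eval x)
      + (1 - x ^ 2) * (derivative^[2] y).eval x
      - 2 * (α + 1) * x * (derivative y).eval x
      + n * (n + 2 * α + 1) * y.eval x = 0

/-- `a₀(n)` (constant in `x`) and the continuous functions `aᵢ`, `i ≥ 1` (independent of `n`), are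
coefficients, independent of `M`, for which every `P_n^{α,α,M,M}` satisfies the differential
equation. -/
def IsCoefficientFamily (α : ℝ) (a₀ : ℕ → ℝ) (a : ℕ → ℝ → ℝ) : Prop :=
  (∀ i, 1 ≤ i → Continuous (a i)) ∧
    ∀ M : ℝ, 0 ≤ M → ∀ n : ℕ, SatisfiesDE α M n (a₀ n) a (genUltraspherical n α M)

/-- The two systems of equations for the coefficients. -/
def SolvesSystems (α : ℝ) (a₀ : ℕ → ℝ) (a : ℕ → ℝ → ℝ) : Prop :=
  (∀ i, 1 ≤ i → Continuous (a i)) ∧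
    (∀ (n : ℕ) (x : ℝ),
      ∑' i : ℕ, opCoeff (a₀ n) a i x * (derivative^[i] (jacobi n α α)).eval x
        = 4 * binomQuot α n * (derivative^[2] (jacobi n α α)).eval x) ∧
    (∀ (n : ℕ) (x : ℝ),
      ∑' i : ℕ, (i : ℝ) * opCoeff (a₀ n) a i x * (derivative^[i] (jacobi n α α)).eval x
          + x * ∑' i : ℕ, opCoeff (a₀ n) a i x * (derivative^[i + 1] (jacobi n α α)).eval x
        = 4 * binom (n + 2 * α + 1) ((n : ℤ) - 1) * (derivative^[2] (jacobi n α α)).eval x)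

/-- `b₀(n)`. -/
def b₀ (n : ℕ) : ℝ := 1 / 2 * (1 - (-1) ^ n)

/-- `c₀(n, α)`. -/
def c₀ (α : ℝ) (n : ℕ) : ℝ :=
  4 * (2 * α + 3) * binom (n + 2 * α + 2) ((n : ℤ) - 2)

/-- `bᵢ(x)` for `i ≥ 1`. -/
def b (i : ℕ) (x : ℝ) : ℝ := 2 ^ (i - 1) / (i.factorial : ℝ) * (-x) ^ i

/-- `cᵢ(x)` for `i ≥ 1`; in particular `c₁ = 0`. -/
def c (α : ℝ) (i : ℕ) (x : ℝ) : ℝ :=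
  if i ≤ 1 then 0
  else (2 * α + 3) * (1 - x ^ 2) * (2 ^ i / (i.factorial : ℝ)) *
    (jacobi (i - 2) (α - i + 3) (α - i + 3)).eval x

end GenUltraspherical

end

noncomputable section

namespace GenUltraspherical

/-! Write P for the classical polynomial of degree n, Q = `binomQuot α n`, B = binom(n+2α+1, n-1)
and λ = n(n+2α+1).

Statements 1 and 2. The constants factor as C₀ = (1+2MB)² and C₁ = 2MQ(1+2MB). The classical
operator annihilates P and sends xP' to 2P'', because D² has commutator 2D² with xD while the
remaining terms commute with xD. Let u and v be the images of P and xP' under the infinite-order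
operator. After division by 1+2MB > 0 the equation becomes M[u - 4QP'' + 2M(Bu - Qv)] = 0. Two
positive values of M force u = 4QP'' and Bu = Qv, hence v = 4BP'' when Q ≠ 0; this is statement 2
(`isCoefficientFamily_iff_solvesSystems`).

Existence. The b-part of the operator is half of "reflection minus identity"; together with b₀(n) it
annihilates P and xP', which both have parity (-1)ⁿ. The c-part is 4(2α+3)(1-x²) times a residue
operator: f is multiplied by (y²-1)^(α+1) (y-x)^(-2α-5) and the residue at y = ∞ is taken. The
related operator `kernelOp α 2` intertwines the ultraspherical equations with parameters α and α+1,
so it sends P to a multiple of P' (`kernelOp_two_jacobi`). Differentiation in x gives the images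
under `kernelOp α 3`, `4`, `5` as multiples of P'', P''', P''''. Both systems then follow from the
differential equation of P and its derivatives.

Uniqueness. By induction on n, the two equations of order n form a linear system for a₀(n) and
aₙ(x). It is nonsingular for n ≥ 2 because nP - xP' is not the zero polynomial; for n = 1 the
equations coincide and a₀(1) stays free (`solvesSystems_unique`). -/

/-! ### Generalized binomial coefficients -/

theorem binom_of_neg (z : ℝ) {k : ℤ} (hk : k < 0) : binom z k = 0 := by
  simp [binom, not_le.mpr hk]

theorem binom_natCast (z : ℝ) (k : ℕ) :
    binom z k = (ascPochhammer ℝ k).eval (z - k + 1) / k.factorial := by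
  rw [binom, if_pos (by positivity), Int.toNat_natCast, Ring.choose_eq_smul,
    Polynomial.descPochhammer_smeval_eq_ascPochhammer, Polynomial.ascPochhammer_smeval_eq_eval, smul_eq_mul]
  rw [div_eq_inv_mul]

theorem binom_zero_right (z : ℝ) : binom z 0 = 1 := by
  simpa using binom_natCast z 0

theorem binom_pascal (z : ℝ) (k : ℤ) : binom (z + 1) k = binom z k + binom z (k - 1) := by
  rcases lt_trichotomy k 0 with h | rfl | h
  · rw [binom_of_neg _ h, binom_of_neg _ h, binom_of_neg _ (by omega)]; simp
  · rw [binom_zero_right, binom_zero_right, binom_of_neg _ (by omega)]; simp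
  · obtain ⟨m, rfl⟩ : ∃ m : ℕ, k = (m + 1 : ℕ) := ⟨(k - 1).toNat, by omega⟩
    have e : ((m + 1 : ℕ) : ℤ) - 1 = (m : ℤ) := by push_cast; ring
    rw [e]
    simp only [binom, Nat.cast_nonneg, if_true, Int.toNat_natCast]
    rw [Ring.choose_succ_succ, add_comm]

theorem binom_succ_right (z : ℝ) (k : ℤ) : (k + 1) * binom z (k + 1) = (z - k) * binom z k := by
  rcases lt_trichotomy (k + 1) 0 with h | h | h
  · rw [binom_of_neg _ h, binom_of_neg _ (by omega)]; simp
  · rw [binom_of_neg _ (show k < 0 by omega), ← Int.cast_one (R := ℝ), ← Int.cast_add, h]; simp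
  · obtain ⟨m, rfl⟩ : ∃ m : ℕ, k = m := ⟨k.toNat, by omega⟩
    rw [show (m : ℤ) + 1 = (m + 1 : ℕ) by push_cast; rfl, binom_natCast, binom_natCast,
      ascPochhammer_succ_left, Nat.factorial_succ]
    have : (m.factorial : ℝ) ≠ 0 := by positivity
    simp only [eval_mul, eval_X, eval_comp, eval_add, eval_one]
    push_cast
    rw [show z - ((m : ℝ) + 1) + 1 + 1 = z - m + 1 by ring]
    field_simp
    ring

theorem binom_absorb (z : ℝ) (k : ℤ) : k * binom z k = z * binom (z - 1) (k - 1) := by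
  have h1 := binom_succ_right (z - 1) (k - 1)
  have h2 := binom_pascal (z - 1) k
  rw [sub_add_cancel] at h1 h2
  push_cast at h1
  rw [h2]
  linear_combination h1

theorem binom_vandermonde (y z : ℝ) (k : ℕ) :
    binom (y + z) k = ∑ i ∈ Finset.range (k + 1), binom y i * binom z ((k : ℤ) - i) := by
  rw [binom, if_pos (by positivity), Int.toNat_natCast, Ring.add_choose_eq k (Commute.all y z),
    Finset.Nat.sum_antidiagonal_eq_sum_range_succ_mk]
  refine Finset.sum_congr rfl fun i hi => ?_
  have hi' : i ≤ k := by simpa [Nat.lt_succ_iff] using hi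
  simp only [binom, Nat.cast_nonneg, if_true, Int.toNat_natCast]
  rw [← Nat.cast_sub hi']
  simp

theorem binom_natCast_left (n k : ℕ) : binom n k = n.choose k := by
  simp [binom, Ring.choose_natCast]

theorem binom_pos (z : ℝ) (k : ℕ) (h : (k : ℝ) - 1 < z) : 0 < binom z k := by
  rw [binom_natCast]
  have := ascPochhammer_pos k (z - k + 1) (by linarith)
  positivity

/-! ### Jacobi polynomials and the ultraspherical equation -/

theorem derivative_jacobi_succ (n : ℕ) (μ ν : ℝ) :
    derivative (jacobi (n + 1) μ ν) = C ((n + μ + ν + 2) / 2) * jacobi n (μ + 1) (ν + 1) := by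
  rw [jacobi, jacobi, Finset.sum_range_succ', derivative_add, derivative_sum, Finset.mul_sum]
  have h0 : derivative (C ((ascPochhammer ℝ 0).eval (((n + 1 : ℕ) : ℝ) + μ + ν + 1) *
      (ascPochhammer ℝ (n + 1 - 0)).eval (μ + ((0 : ℕ) : ℝ) + 1) /
        ((Nat.factorial 0 : ℝ) * (n + 1 - 0).factorial)) *
      (C (1 / 2) * (X - 1)) ^ 0 : ℝ[X]) = 0 := by
    rw [pow_zero, mul_one, derivative_C]
  rw [h0, add_zero]
  refine Finset.sum_congr rfl fun k _ => ?_
  rw [derivative_C_mul, derivative_pow]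
  have hd : derivative (C (1 / 2) * (X - 1) : ℝ[X]) = C (1 / 2) := by
    rw [derivative_C_mul]; simp
  rw [hd, Nat.add_sub_add_right, Nat.add_sub_cancel, ascPochhammer_succ_left]
  simp only [eval_mul, eval_X, eval_comp, eval_add, eval_one]
  have e : C ((((n + 1 : ℕ) : ℝ) + μ + ν + 1) *
      (ascPochhammer ℝ k).eval (((n + 1 : ℕ) : ℝ) + μ + ν + 1 + 1) *
      (ascPochhammer ℝ (n - k)).eval (μ + ((k + 1 : ℕ) : ℝ) + 1) /
        (((k + 1).factorial : ℝ) * (n - k).factorial)) * C (((k + 1 : ℕ)) : ℝ) * C (1 / 2) =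
      C ((n + μ + ν + 2) / 2) * C ((ascPochhammer ℝ k).eval ((n : ℝ) + (μ + 1) + (ν + 1) + 1) *
      (ascPochhammer ℝ (n - k)).eval (μ + 1 + (k : ℝ) + 1) /
        ((k.factorial : ℝ) * (n - k).factorial)) := by
    simp only [← C_mul]
    congr 1
    rw [Nat.factorial_succ]
    push_cast
    rw [show (n : ℝ) + 1 + μ + ν + 1 + 1 = n + (μ + 1) + (ν + 1) + 1 by ring,
      show μ + ((k : ℝ) + 1) + 1 = μ + 1 + k + 1 by ring]
    have h1 : (k.factorial : ℝ) ≠ 0 := by positivity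
    have h2 : ((n - k).factorial : ℝ) ≠ 0 := by positivity
    have h3 : (k : ℝ) + 1 ≠ 0 := by positivity
    field_simp
    ring
  linear_combination (C (1 / 2) * (X - 1)) ^ k * e

theorem jacobi_zero (μ ν : ℝ) : jacobi 0 μ ν = 1 := by
  simp [jacobi]

theorem eval_one_jacobi (n : ℕ) (μ ν : ℝ) : (jacobi n μ ν).eval 1 = binom (n + μ) n := by
  rw [jacobi, eval_finsetSum, Finset.sum_range_succ', binom_natCast]
  simp

theorem natDegree_jacobi_le (n : ℕ) (μ ν : ℝ) : (jacobi n μ ν).natDegree ≤ n := by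
  refine natDegree_sum_le_of_forall_le _ _ fun k hk => ?_
  have hk' : k ≤ n := by simpa [Nat.lt_succ_iff] using hk
  refine (natDegree_C_mul_le _ _).trans ((natDegree_pow_le).trans ?_)
  have : (C (1 / 2) * (X - 1) : ℝ[X]).natDegree ≤ 1 :=
    (natDegree_C_mul_le _ _).trans (natDegree_X_sub_C (1 : ℝ)).le
  nlinarith

theorem coeff_jacobi_succ (n : ℕ) (μ ν : ℝ) :
    ((n : ℝ) + 1) * (jacobi (n + 1) μ ν).coeff (n + 1) =
      (n + μ + ν + 2) / 2 * (jacobi n (μ + 1) (ν + 1)).coeff n := by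
  have h := congrArg (fun p => coeff p n) (derivative_jacobi_succ n μ ν)
  simp only [coeff_derivative, coeff_C_mul] at h
  linear_combination h

theorem coeff_jacobi_pos {α : ℝ} (hα : -1 < α) (n : ℕ) : 0 < (jacobi n α α).coeff n := by
  induction n generalizing α with
  | zero => simp [jacobi_zero]
  | succ n ih =>
    have h := coeff_jacobi_succ n α α
    have h1 : 0 < (n + α + α + 2) / 2 * (jacobi n (α + 1) (α + 1)).coeff n := by
      have hn : (0 : ℝ) ≤ n := n.cast_nonneg
      have := ih (show -1 < α + 1 by linarith)
      have : 0 < (n + α + α + 2) / 2 := by linarith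
      positivity
    rw [← h] at h1
    exact (pos_iff_pos_of_mul_pos h1).mp (by positivity)

theorem natDegree_jacobi {α : ℝ} (hα : -1 < α) (n : ℕ) : (jacobi n α α).natDegree = n :=
  natDegree_eq_of_le_of_coeff_ne_zero (natDegree_jacobi_le n α α) (coeff_jacobi_pos hα n).ne'

/-- A polynomial is zero if its derivative and its value at `1` are zero. -/
theorem eq_zero_of_derivative_of_eval_one {p : ℝ[X]} (h : derivative p = 0) (h1 : p.eval 1 = 0) :
    p = 0 := by
  rw [eq_C_of_derivative_eq_zero h] at h1 ⊢
  simp at h1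
  simp [h1]

/-- The ultraspherical differential equation. -/
theorem jacobi_ode (n : ℕ) (α : ℝ) :
    (1 - X ^ 2) * derivative (derivative (jacobi n α α))
      - C (2 * (α + 1)) * X * derivative (jacobi n α α)
      + C (n * (n + 2 * α + 1)) * jacobi n α α = 0 := by
  induction n generalizing α with
  | zero => simp [jacobi_zero]
  | succ n ih =>
    -- Differentiation turns the equation for (n+1, α) into a multiple of the one for (n, α+1); the
    -- value at 1 fixes the constant of integration.
    apply eq_zero_of_derivative_of_eval_one
    · have h := ih (α + 1)
      have hP := derivative_jacobi_succ n α α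
      simp only [derivative_add, derivative_sub, derivative_mul, derivative_C, derivative_one,
        derivative_X_pow, derivative_X, hP, zero_mul, zero_add]
      simp only [C_mul, C_add, C_1, map_natCast, map_ofNat] at h ⊢
      push_cast at h ⊢
      linear_combination C ((n + α + α + 2) / 2) * h
    · have h1 := eval_one_jacobi (n + 1) α α
      have h2 := eval_one_jacobi n (α + 1) (α + 1)
      have hb := binom_succ_right (((n + 1 : ℕ) : ℝ) + α) n
      rw [show (n : ℝ) + (α + 1) = ((n + 1 : ℕ) : ℝ) + α by push_cast; ring] at h2
      rw [derivative_jacobi_succ]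
      simp only [eval_add, eval_sub, eval_mul, eval_pow, eval_X, eval_C, eval_one, h1, h2]
      push_cast at hb ⊢
      linear_combination ((n : ℝ) + 2 * α + 2) * hb

/-- A polynomial solution of degree less than `n` of the ultraspherical equation of order `n`
is zero. -/
theorem eq_zero_of_ode {γ : ℝ} (hγ : 0 < γ) {n : ℕ} {y : ℝ[X]} (hy : ∀ k, n ≤ k → y.coeff k = 0)
    (h : (1 - X ^ 2) * derivative (derivative y) - C (2 * γ) * X * derivative y
      + C (n * (n + 2 * γ - 1)) * y = 0) : y = 0 := by
  by_contra hne
  set d := y.natDegree with hd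
  have hlc : y.coeff d ≠ 0 := by simpa [hd] using hne
  have hdn : d < n := by
    by_contra hcon
    exact hlc (hy d (not_lt.mp hcon))
  have hc := congrArg (fun p => coeff p d) h
  have e1 : ((1 - X ^ 2) * derivative (derivative y) : ℝ[X]).coeff d = - (d * (d - 1)) * y.coeff d := by
    have h2 : (derivative (derivative y)).coeff d = 0 := by
      rw [coeff_derivative, coeff_derivative, coeff_eq_zero_of_natDegree_lt (by omega)]; simp
    rw [sub_mul, one_mul, coeff_sub, h2]
    rcases d with _ | _ | d
    · simp
    · simp [coeff_X_pow_mul']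
    · rw [coeff_X_pow_mul, coeff_derivative, coeff_derivative]
      push_cast; ring
  have e2 : (X * derivative y).coeff d = d * y.coeff d := by
    rcases d with _ | d
    · simp
    · rw [coeff_X_mul, coeff_derivative]; push_cast; ring
  simp only [mul_assoc, coeff_add, coeff_sub, coeff_C_mul, coeff_zero] at hc
  rw [e1, e2] at hc
  -- This is the factor by which the equation multiplies the leading coefficient of a solution of
  -- degree d < n.
  have hpos : 0 < ((n : ℝ) - d) * (n + d + 2 * γ - 1) := by
    have : (d : ℝ) + 1 ≤ n := by exact_mod_cast hdn
    have : (0 : ℝ) ≤ d := d.cast_nonneg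
    apply mul_pos <;> linarith
  have : ((n : ℝ) - d) * (n + d + 2 * γ - 1) * y.coeff d = 0 := by linear_combination hc
  rcases mul_eq_zero.mp this with h | h
  · exact hpos.ne' h
  · exact hlc h

/-! ### The generating function of the kernel -/

/-- The coefficient of `z ^ m` in the expansion of `((1 + x z) ^ 2 - z ^ 2) ^ β`. -/
def kernelCoeff (β : ℝ) (m : ℤ) : ℝ[X] :=
  if 0 ≤ m then C (2 ^ m) * jacobi m.toNat (β - m) (β - m) else 0

theorem kernelCoeff_natCast (β : ℝ) (m : ℕ) :
    kernelCoeff β m = C (2 ^ m) * jacobi m (β - m) (β - m) := by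
  simp [kernelCoeff]

theorem kernelCoeff_of_neg (β : ℝ) {m : ℤ} (hm : m < 0) : kernelCoeff β m = 0 := by
  simp [kernelCoeff, not_le.mpr hm]

theorem kernelCoeff_zero (β : ℝ) : kernelCoeff β 0 = 1 := by
  simpa [jacobi_zero] using kernelCoeff_natCast β 0

theorem derivative_kernelCoeff (β : ℝ) (m : ℤ) :
    derivative (kernelCoeff β m) = C (2 * β - m + 1) * kernelCoeff β (m - 1) := by
  rcases lt_trichotomy m 0 with h | rfl | h
  · rw [kernelCoeff_of_neg _ h, kernelCoeff_of_neg _ (by omega)]; simp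
  · rw [kernelCoeff_zero, kernelCoeff_of_neg _ (by omega)]; simp
  · obtain ⟨k, rfl⟩ : ∃ k : ℕ, m = (k + 1 : ℕ) := ⟨(m - 1).toNat, by omega⟩
    rw [show ((k + 1 : ℕ) : ℤ) - 1 = k by push_cast; ring, kernelCoeff_natCast,
      kernelCoeff_natCast, derivative_C_mul, derivative_jacobi_succ, ← mul_assoc, ← mul_assoc,
      ← C_mul, ← C_mul]
    push_cast
    rw [show β - ((k : ℝ) + 1) + 1 = β - k by ring]
    congr 2
    ring

theorem eval_one_kernelCoeff (β : ℝ) (m : ℤ) : (kernelCoeff β m).eval 1 = 2 ^ m * binom β m := by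
  rcases lt_or_ge m 0 with h | h
  · rw [kernelCoeff_of_neg _ h, binom_of_neg _ h]; simp
  · obtain ⟨k, rfl⟩ := Int.eq_ofNat_of_zero_le h
    rw [kernelCoeff_natCast, eval_mul, eval_C, eval_one_jacobi, add_sub_cancel]
    simp

theorem natDegree_kernelCoeff_le (β : ℝ) (m : ℕ) : (kernelCoeff β m).natDegree ≤ m := by
  rw [kernelCoeff_natCast]
  exact (natDegree_C_mul_le _ _).trans (natDegree_jacobi_le _ _ _)

/-- The terms of top degree in x come from (1+xz)^(2β). -/
theorem coeff_kernelCoeff (β : ℝ) (m : ℕ) : (kernelCoeff β m).coeff m = binom (2 * β) m := by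
  induction m with
  | zero => simpa [binom_zero_right] using congrArg (coeff · 0) (kernelCoeff_zero β)
  | succ m ih =>
    have h := congrArg (coeff · m) (derivative_kernelCoeff β (m + 1 : ℕ))
    have hb := binom_succ_right (2 * β) m
    rw [show ((m + 1 : ℕ) : ℤ) - 1 = m by push_cast; ring] at h
    simp only [coeff_derivative, coeff_C_mul, ih] at h
    push_cast at h hb ⊢
    have h0 : (m : ℝ) + 1 ≠ 0 := by positivity
    apply mul_left_cancel₀ h0
    linear_combination h - hb

/-- A sequence of polynomials `R m` with `R m' = κ m * R (m - 1)` and `R m (1) = 0` is zero. -/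
theorem eq_zero_of_derivative_eq {R : ℤ → ℝ[X]} {κ : ℤ → ℝ} (hneg : ∀ m < 0, R m = 0)
    (hd : ∀ m, derivative (R m) = C (κ m) * R (m - 1)) (h1 : ∀ m, (R m).eval 1 = 0) (m : ℤ) :
    R m = 0 := by
  have key : ∀ n : ℕ, R ((n : ℤ) - 1) = 0 := by
    intro n
    induction n with
    | zero => exact hneg _ (by simp)
    | succ n ih =>
      refine eq_zero_of_derivative_of_eval_one ?_ (h1 _)
      rw [hd, show ((n + 1 : ℕ) : ℤ) - 1 - 1 = (n : ℤ) - 1 by push_cast; ring, ih, mul_zero]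
  rcases lt_or_ge m 0 with h | h
  · exact hneg m h
  · have := key (m + 1).toNat
    rwa [show (((m + 1).toNat : ℕ) : ℤ) - 1 = m by omega] at this

theorem two_zpow_sub_one (m : ℤ) : (2 : ℝ) ^ (m - 1) = 2 ^ m / 2 := by
  rw [zpow_sub₀ two_ne_zero, zpow_one]

theorem two_zpow_sub_two (m : ℤ) : (2 : ℝ) ^ (m - 2) = 2 ^ m / 4 := by
  rw [zpow_sub₀ two_ne_zero]; norm_num

/-- With w = (1+xz)² - z² and F = w^β this is the identity w F_z = 2β(x(1+xz) - z)F. The defects for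
successive m are linked by x-differentiation, so it is enough to check x = 1, where only binomial
coefficients remain. The next two identities are proved in the same way. -/
theorem kernelCoeff_three_term (β : ℝ) (m : ℤ) :
    C (m : ℝ) * kernelCoeff β m = C (2 * (β - m + 1)) * X * kernelCoeff β (m - 1)
      + C (2 * β - m + 2) * (X ^ 2 - 1) * kernelCoeff β (m - 2) := by
  rw [← sub_eq_zero]
  refine eq_zero_of_derivative_eq (R := fun m => C (m : ℝ) * kernelCoeff β m
    - (C (2 * (β - m + 1)) * X * kernelCoeff β (m - 1)
      + C (2 * β - m + 2) * (X ^ 2 - 1) * kernelCoeff β (m - 2)))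
    (κ := fun m => 2 * β - m + 2) ?_ ?_ ?_ m
  · intro m hm
    simp only [kernelCoeff_of_neg β hm, kernelCoeff_of_neg β (show m - 1 < 0 by omega),
      kernelCoeff_of_neg β (show m - 2 < 0 by omega)]
    simp
  · intro m
    simp only [derivative_add, derivative_sub, derivative_mul, derivative_C, derivative_X,
      derivative_X_pow, derivative_one, derivative_kernelCoeff]
    rw [show m - 1 - 1 = m - 2 by ring, show m - 2 - 1 = m - 3 by ring,
      show m - 1 - 2 = m - 3 by ring]
    simp only [C_mul, C_add, C_sub, C_1, Nat.cast_ofNat, map_ofNat, map_intCast]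
    push_cast
    ring
  · intro m
    have h := binom_succ_right β (m - 1)
    rw [sub_add_cancel] at h
    simp only [eval_add, eval_sub, eval_mul, eval_C, eval_X, eval_pow, eval_one,
      eval_one_kernelCoeff, two_zpow_sub_one]
    push_cast at h ⊢
    linear_combination 2 ^ m * h

/-- Multiplication of the generating function by 1 + 2xz + (x²-1)z². -/
theorem kernelCoeff_add_one (β : ℝ) (m : ℤ) :
    kernelCoeff (β + 1) m = kernelCoeff β m + 2 * X * kernelCoeff β (m - 1)
      + (X ^ 2 - 1) * kernelCoeff β (m - 2) := by
  rw [← sub_eq_zero]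
  refine eq_zero_of_derivative_eq (R := fun m => kernelCoeff (β + 1) m -
    (kernelCoeff β m + 2 * X * kernelCoeff β (m - 1) + (X ^ 2 - 1) * kernelCoeff β (m - 2)))
    (κ := fun m => 2 * β - m + 3) ?_ ?_ ?_ m
  · intro m hm
    simp only [kernelCoeff_of_neg _ hm, kernelCoeff_of_neg β (show m - 1 < 0 by omega),
      kernelCoeff_of_neg β (show m - 2 < 0 by omega)]
    simp
  · intro m
    simp only [derivative_add, derivative_sub, derivative_mul, derivative_X, derivative_ofNat,
      derivative_X_pow, derivative_one, derivative_kernelCoeff]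
    rw [show m - 1 - 1 = m - 2 by ring, show m - 2 - 1 = m - 3 by ring,
      show m - 1 - 2 = m - 3 by ring]
    simp only [C_mul, C_add, C_sub, C_1, Nat.cast_ofNat, map_ofNat, map_intCast]
    push_cast
    ring
  · intro m
    simp only [eval_add, eval_sub, eval_mul, eval_X, eval_pow, eval_one, eval_ofNat,
      eval_one_kernelCoeff, two_zpow_sub_one, binom_pascal]
    ring

/-- The vector field z∂_z - x∂_x annihilates (1+xz)² and sees only -z², which produces the term with
exponent β-1. -/
theorem kernelCoeff_euler (β : ℝ) (m : ℤ) :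
    C (m : ℝ) * kernelCoeff β m - C (2 * β - m + 1) * X * kernelCoeff β (m - 1)
      + C (2 * β) * kernelCoeff (β - 1) (m - 2) = 0 := by
  refine eq_zero_of_derivative_eq (R := fun m => C (m : ℝ) * kernelCoeff β m
    - C (2 * β - m + 1) * X * kernelCoeff β (m - 1) + C (2 * β) * kernelCoeff (β - 1) (m - 2))
    (κ := fun m => 2 * β - m + 1) ?_ ?_ ?_ m
  · intro m hm
    simp only [kernelCoeff_of_neg _ hm, kernelCoeff_of_neg β (show m - 1 < 0 by omega),
      kernelCoeff_of_neg (β - 1) (show m - 2 < 0 by omega)]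
    simp
  · intro m
    simp only [derivative_add, derivative_sub, derivative_mul, derivative_X, derivative_C,
      derivative_kernelCoeff]
    rw [show m - 1 - 1 = m - 2 by ring, show m - 2 - 1 = m - 3 by ring,
      show m - 1 - 2 = m - 3 by ring]
    simp only [C_mul, C_add, C_sub, C_1, map_ofNat, map_intCast]
    push_cast
    ring
  · intro m
    have h := binom_succ_right β (m - 1)
    have h2 := binom_absorb β (m - 1)
    rw [sub_add_cancel] at h
    rw [show m - 1 - 1 = m - 2 by ring] at h2
    simp only [eval_add, eval_sub, eval_mul, eval_C, eval_X,
      eval_one_kernelCoeff, two_zpow_sub_one, two_zpow_sub_two]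
    push_cast at h h2 ⊢
    linear_combination 2 ^ m * h - 2 ^ m / 2 * h2

/-! ### Differential operators with polynomial coefficients -/

/-- The differential operator `∑ hᵢ Dⁱ / i!` on polynomials. -/
def diffOp (h : ℤ → ℝ[X]) (f : ℝ[X]) : ℝ[X] :=
  ∑ i ∈ Finset.range (f.natDegree + 1), C (1 / (i.factorial : ℝ)) * h i * derivative^[i] f

theorem diffOp_eq_sum (h : ℤ → ℝ[X]) {f : ℝ[X]} {N : ℕ} (hN : f.natDegree < N) :
    diffOp h f = ∑ i ∈ Finset.range N, C (1 / (i.factorial : ℝ)) * h i * derivative^[i] f := by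
  refine Finset.sum_subset (Finset.range_mono hN) fun i _ hi => ?_
  rw [iterate_derivative_eq_zero (by simpa using hi), mul_zero]

theorem diffOp_add_right (h : ℤ → ℝ[X]) (f g : ℝ[X]) :
    diffOp h (f + g) = diffOp h f + diffOp h g := by
  have h1 := natDegree_add_le f g
  rw [diffOp_eq_sum h (N := max f.natDegree g.natDegree + 1) (by omega),
    diffOp_eq_sum h (f := f) (N := max f.natDegree g.natDegree + 1) (by omega),
    diffOp_eq_sum h (f := g) (N := max f.natDegree g.natDegree + 1) (by omega),
    ← Finset.sum_add_distrib]
  exact Finset.sum_congr rfl fun i _ => by rw [iterate_map_add, mul_add]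

theorem diffOp_C_mul_right (h : ℤ → ℝ[X]) (r : ℝ) (f : ℝ[X]) :
    diffOp h (C r * f) = C r * diffOp h f := by
  have h1 := natDegree_C_mul_le r f
  rw [diffOp_eq_sum h (N := f.natDegree + 1) (by omega), diffOp, Finset.mul_sum]
  exact Finset.sum_congr rfl fun i _ => by rw [iterate_derivative_C_mul]; ring

theorem diffOp_add_left (h k : ℤ → ℝ[X]) (f : ℝ[X]) :
    diffOp (fun i => h i + k i) f = diffOp h f + diffOp k f := by
  simp only [diffOp, mul_add, add_mul, Finset.sum_add_distrib]

theorem diffOp_mul_left (p : ℝ[X]) (h : ℤ → ℝ[X]) (f : ℝ[X]) :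
    diffOp (fun i => p * h i) f = p * diffOp h f := by
  simp only [diffOp, Finset.mul_sum]
  exact Finset.sum_congr rfl fun i _ => by ring

theorem diffOp_derivative (h : ℤ → ℝ[X]) (f : ℝ[X]) :
    diffOp h (derivative f) = diffOp (fun i => C (i : ℝ) * h (i - 1)) f := by
  rw [diffOp_eq_sum h (f := derivative f) (N := f.natDegree + 1)
    (by have := natDegree_derivative_le f; omega),
    diffOp_eq_sum _ (f := f) (N := f.natDegree + 1 + 1) (by omega),
    Finset.sum_range_succ' _ (f.natDegree + 1)]
  simp only [← Function.iterate_succ_apply, Nat.cast_zero, Int.cast_zero, C_0, zero_mul, mul_zero,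
    add_zero]
  refine Finset.sum_congr rfl fun i _ => ?_
  rw [← mul_assoc, ← C_mul, show ((i + 1 : ℕ) : ℤ) - 1 = i by push_cast; ring]
  congr 3
  rw [Nat.factorial_succ]
  push_cast
  have : (i.factorial : ℝ) ≠ 0 := by positivity
  field_simp

theorem derivative_diffOp (h : ℤ → ℝ[X]) (f : ℝ[X]) :
    derivative (diffOp h f) =
      diffOp (fun i => derivative (h i)) f + diffOp h (derivative f) := by
  rw [diffOp_eq_sum h (f := derivative f) (N := f.natDegree + 1)
    (by have := natDegree_derivative_le f; omega)]
  simp only [diffOp, derivative_sum, derivative_mul, derivative_C, zero_mul, zero_add,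
    Finset.sum_add_distrib, ← Function.iterate_succ_apply', ← Function.iterate_succ_apply]

theorem iterate_derivative_X_mul_eq (f : ℝ[X]) (i : ℕ) :
    derivative^[i] (X * f) = X * derivative^[i] f + C (i : ℝ) * derivative^[i - 1] f := by
  induction i with
  | zero => simp
  | succ i ih =>
    rw [Function.iterate_succ_apply', ih]
    simp only [derivative_add, derivative_mul, derivative_X, derivative_C, zero_mul,
      zero_add, one_mul, ← Function.iterate_succ_apply']
    rcases i with _ | i
    · simp; ring
    · simp; ring

theorem diffOp_X_mul (h : ℤ → ℝ[X]) (f : ℝ[X]) :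
    diffOp h (X * f) = X * diffOp h f + diffOp (fun i => h (i + 1)) f := by
  have h1 : (X * f).natDegree ≤ f.natDegree + 1 := by
    simpa [add_comm] using natDegree_mul_le (p := X) (q := f)
  rw [diffOp_eq_sum h (f := X * f) (N := f.natDegree + 1 + 1) (by omega),
    diffOp_eq_sum h (f := f) (N := f.natDegree + 1 + 1) (by omega)]
  simp only [iterate_derivative_X_mul_eq, mul_add, Finset.sum_add_distrib, Finset.mul_sum]
  congr 1
  · exact Finset.sum_congr rfl fun i _ => by ring
  · rw [Finset.sum_range_succ', diffOp]
    simp only [Nat.cast_zero, C_0, zero_mul, mul_zero, add_zero, Nat.add_sub_cancel]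
    refine Finset.sum_congr rfl fun i _ => ?_
    have e : C (1 / ((i + 1).factorial : ℝ)) * C ((i + 1 : ℕ) : ℝ) = C (1 / (i.factorial : ℝ)) := by
      rw [← C_mul, Nat.factorial_succ]
      congr 1
      have : (i.factorial : ℝ) ≠ 0 := by positivity
      push_cast
      field_simp
    rw [← e]
    push_cast
    ring

/-! ### The residue operators -/

/-- The operators `f ↦ Res_{y = ∞} f(y) (y² - 1) ^ α (y - x) ^ (- 2 α - j) dy`, up to sign. -/
def kernelOp (α : ℝ) (j : ℤ) (f : ℝ[X]) : ℝ[X] :=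
  diffOp (fun i => kernelCoeff α (i + 1 - j)) f

theorem derivative_kernelOp (α : ℝ) (j : ℤ) (f : ℝ[X]) :
    derivative (kernelOp α j f) = C (2 * α + j) * kernelOp α (j + 1) f := by
  rw [kernelOp, kernelOp, derivative_diffOp, diffOp_derivative, ← diffOp_add_left,
    ← diffOp_mul_left]
  congr 1
  funext i
  rw [derivative_kernelCoeff, show i + 1 - j - 1 = i - j by ring,
    show i - 1 + 1 - j = i - j by ring, show i + 1 - (j + 1) = i - j by ring, ← add_mul, ← C_add]
  push_cast
  congr 2
  ring

/-- Under the residue, y = x + (y - x), and the factor y - x lowers j by one. -/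
theorem kernelOp_X_mul (α : ℝ) (j : ℤ) (f : ℝ[X]) :
    kernelOp α j (X * f) = X * kernelOp α j f + kernelOp α (j - 1) f := by
  rw [kernelOp, diffOp_X_mul]
  congr 2
  funext i
  congr 1
  ring

theorem kernelOp_add (α : ℝ) (j : ℤ) (f g : ℝ[X]) :
    kernelOp α j (f + g) = kernelOp α j f + kernelOp α j g := diffOp_add_right _ _ _

theorem kernelOp_C_mul (α : ℝ) (j : ℤ) (r : ℝ) (f : ℝ[X]) :
    kernelOp α j (C r * f) = C r * kernelOp α j f := diffOp_C_mul_right _ _ _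

/-- The operator `kernelOp α 2` intertwines the ultraspherical differential operators with
parameters `α` and `α + 1`. -/
theorem kernelOp_two_intertwine (α : ℝ) (f : ℝ[X]) :
    (1 - X ^ 2) * derivative (derivative (kernelOp α 2 f))
      - C (2 * (α + 2)) * X * derivative (kernelOp α 2 f) =
    kernelOp α 2 ((1 - X ^ 2) * derivative (derivative f) - C (2 * (α + 1)) * X * derivative f)
      + C (2 * α + 2) * kernelOp α 2 f := by
  have e : (1 - X ^ 2) * derivative (derivative f) - C (2 * (α + 1)) * X * derivative f =
      derivative (derivative f) + C (-1) * (X * (X * derivative (derivative f)))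
        + C (- (2 * (α + 1))) * (X * derivative f) := by
    simp only [C_neg, C_1]; ring
  rw [e, kernelOp_add, kernelOp_add, kernelOp_C_mul, kernelOp_C_mul]
  simp only [kernelOp_X_mul]
  simp only [derivative_kernelOp, derivative_C_mul]
  simp only [kernelOp, diffOp_derivative]
  simp only [diffOp, Finset.mul_sum, ← Finset.sum_add_distrib, ← Finset.sum_sub_distrib]
  refine Finset.sum_congr rfl fun i _ => ?_
  -- The coefficients of each derivative of f agree by i + 2α + 2 times the three-term recurrence.
  have h := kernelCoeff_three_term α ((i : ℤ) - 1)
  rw [show (i : ℤ) - 1 - 1 = i - 2 by ring, show (i : ℤ) - 1 - 2 = i - 3 by ring] at h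
  rw [show (i : ℤ) + 1 - (2 + 1 + 1) = i - 3 by ring, show (i : ℤ) + 1 - (2 + 1) = i - 2 by ring,
    show (i : ℤ) - 1 - 1 + 1 - 2 = i - 3 by ring, show (i : ℤ) - 1 - 1 + 1 - (2 - 1) = i - 2 by ring,
    show (i : ℤ) - 1 - 1 + 1 - (2 - 1 - 1) = i - 1 by ring, show (i : ℤ) - 1 + 1 - 2 = i - 2 by ring,
    show (i : ℤ) - 1 + 1 - (2 - 1) = i - 1 by ring, show (i : ℤ) + 1 - 2 = i - 1 by ring]
  push_cast at h ⊢
  simp only [C_mul, C_add, C_sub, C_neg, C_1, map_ofNat] at h ⊢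
  linear_combination C (1 / (i.factorial : ℝ)) * (C (i : ℝ) + 2 * C α + 2) * derivative^[i] f * h

/-- `kernelOp (α + 1) 3` in terms of the operators with parameter `α`. -/
theorem kernelOp_add_one_three (α : ℝ) (f : ℝ[X]) :
    kernelOp (α + 1) 3 f =
      kernelOp α 3 f + 2 * X * kernelOp α 4 f + (X ^ 2 - 1) * kernelOp α 5 f := by
  simp only [kernelOp, ← diffOp_mul_left, ← diffOp_add_left]
  congr 1
  funext i
  rw [kernelCoeff_add_one, show i + 1 - 3 - 1 = i + 1 - 4 by ring,
    show i + 1 - 3 - 2 = i + 1 - 5 by ring]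

/-- Commutation with xD, needed for the second system; coefficientwise it is `kernelCoeff_euler`. -/
theorem kernelOp_add_one_three_X_mul_derivative (α : ℝ) (f : ℝ[X]) :
    kernelOp (α + 1) 3 (X * derivative f) = X * derivative (kernelOp (α + 1) 3 f)
      + 2 * kernelOp (α + 1) 3 f - C (2 * (α + 1)) * kernelOp α 5 f := by
  rw [kernelOp_X_mul, derivative_kernelOp]
  simp only [kernelOp, diffOp_derivative]
  simp only [diffOp, Finset.mul_sum, ← Finset.sum_add_distrib, ← Finset.sum_sub_distrib]
  refine Finset.sum_congr rfl fun i _ => ?_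
  have h := kernelCoeff_euler (α + 1) ((i : ℤ) - 2)
  rw [show (i : ℤ) - 2 - 1 = i - 3 by ring, show (i : ℤ) - 2 - 2 = i - 4 by ring,
    add_sub_cancel_right] at h
  rw [show (i : ℤ) - 1 + 1 - 3 = i - 3 by ring, show (i : ℤ) - 1 + 1 - (3 - 1) = i - 2 by ring,
    show (i : ℤ) + 1 - (3 + 1) = i - 3 by ring, show (i : ℤ) + 1 - 3 = i - 2 by ring,
    show (i : ℤ) + 1 - 5 = i - 4 by ring]
  push_cast at h ⊢
  simp only [C_mul, C_add, C_sub, C_1, map_ofNat] at h ⊢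
  linear_combination C (1 / (i.factorial : ℝ)) * derivative^[i] f * h

theorem kernelOp_two_one (α : ℝ) : kernelOp α 2 1 = 0 := by
  simp [kernelOp, diffOp, kernelCoeff_of_neg]

theorem natDegree_kernelOp_two_le (α : ℝ) {f : ℝ[X]} {m : ℕ} (hf : f.natDegree ≤ m + 1) :
    (kernelOp α 2 f).natDegree ≤ m := by
  rw [kernelOp, diffOp_eq_sum _ (N := m + 1 + 1) (by omega)]
  refine natDegree_sum_le_of_forall_le _ _ fun i hi => ?_
  have hi' : i ≤ m + 1 := by simpa [Nat.lt_succ_iff] using hi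
  rcases i with _ | k
  · simp [kernelCoeff_of_neg]
  · rw [show ((k + 1 : ℕ) : ℤ) + 1 - 2 = k by push_cast; ring, mul_assoc]
    refine (natDegree_C_mul_le _ _).trans (natDegree_mul_le.trans ?_)
    have h1 := natDegree_kernelCoeff_le α k
    have h2 := natDegree_iterate_derivative f (k + 1)
    omega

/-- Only top coefficients contribute: binom(2α, k) from the kernel and an ordinary binomial
coefficient of m+1 from the derivatives of f. Vandermonde sums the products. -/
theorem coeff_kernelOp_two (α : ℝ) {f : ℝ[X]} {m : ℕ} (hf : f.natDegree ≤ m + 1) :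
    (kernelOp α 2 f).coeff m = binom (2 * α + (m + 1 : ℕ)) m * f.coeff (m + 1) := by
  rw [kernelOp, diffOp_eq_sum _ (N := m + 1 + 1) (by omega), finsetSum_coeff,
    Finset.sum_range_succ', binom_vandermonde, Finset.sum_mul]
  simp only [Nat.cast_zero]
  rw [kernelCoeff_of_neg α (by norm_num), mul_zero, zero_mul, coeff_zero, add_zero]
  refine Finset.sum_congr rfl fun k hk => ?_
  have hk' : k ≤ m := by simpa [Nat.lt_succ_iff] using hk
  obtain ⟨l, rfl⟩ := Nat.exists_eq_add_of_le hk'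
  rw [show ((k + 1 : ℕ) : ℤ) + 1 - 2 = k by push_cast; ring, mul_assoc, coeff_C_mul,
    coeff_mul_add_eq_of_natDegree_le (natDegree_kernelCoeff_le α k)
      ((natDegree_iterate_derivative f (k + 1)).trans (by omega)),
    coeff_kernelCoeff, coeff_iterate_derivative, show ((k + l : ℕ) : ℤ) - k = l by push_cast; ring,
    binom_natCast_left, show l + (k + 1) = k + l + 1 by ring, nsmul_eq_mul,
    Nat.descFactorial_eq_factorial_mul_choose,
    ← Nat.choose_symm_of_eq_add (show k + l + 1 = (k + 1) + l by ring)]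
  have : ((k + 1).factorial : ℝ) ≠ 0 := by positivity
  push_cast
  field_simp

/-- For n ≥ 1 both sides satisfy the ultraspherical equation with parameter α+1 and order n-1: the
left by intertwining, the right by differentiation of the equation of P. Their coefficients of
degree n-1 agree, so the difference is a solution of too low a degree. -/
theorem kernelOp_two_jacobi {α : ℝ} (hα : -1 < α) (n : ℕ) :
    kernelOp α 2 (jacobi n α α) = C (binomQuot α n) * derivative (jacobi n α α) := by
  rcases n with _ | m
  · simp [jacobi_zero, kernelOp_two_one]
  set P := jacobi (m + 1) α α with hP
  have hdeg : P.natDegree ≤ m + 1 := natDegree_jacobi_le _ _ _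
  have hE := jacobi_ode (m + 1) α
  rw [← hP] at hE
  rw [← sub_eq_zero]
  refine eq_zero_of_ode (γ := α + 2) (n := m) (by linarith) ?_ ?_
  · intro k hk
    rcases hk.eq_or_lt with rfl | hk
    · rw [coeff_sub, coeff_kernelOp_two α hdeg, coeff_C_mul, coeff_derivative,
        binomQuot_eq _ _ (by omega), show ((m + 1 : ℕ) : ℤ) - 1 = m by push_cast; ring, add_comm]
      have : (m : ℝ) + 1 ≠ 0 := by positivity
      push_cast
      field_simp
      ring
    · rw [coeff_sub, coeff_eq_zero_of_natDegree_lt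
        ((natDegree_kernelOp_two_le α hdeg).trans_lt hk), coeff_C_mul, coeff_derivative,
        coeff_eq_zero_of_natDegree_lt (by omega)]
      simp
  · have h1 := kernelOp_two_intertwine α P
    have e : (1 - X ^ 2) * derivative (derivative P) - C (2 * (α + 1)) * X * derivative P =
        C (-(((m + 1 : ℕ) : ℝ) * ((m + 1 : ℕ) + 2 * α + 1))) * P := by
      rw [C_neg]; linear_combination hE
    rw [e, kernelOp_C_mul] at h1
    have h2 := congrArg derivative hE
    simp only [derivative_add, derivative_sub, derivative_mul, derivative_C, derivative_X,
      derivative_X_pow, derivative_one, derivative_zero] at h2 ⊢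
    push_cast at h1 h2 ⊢
    simp only [C_mul, C_add, C_sub, C_neg, C_1, map_ofNat, map_natCast] at h1 h2 ⊢
    linear_combination h1 - C (binomQuot α (m + 1)) * h2

/-! ### The constants in terms of the eigenvalue n(n+2α+1) -/

theorem binom_succ_left (z : ℝ) (k : ℤ) :
    (z + 1 - k) * binom (z + 1) k = (z + 1) * binom z k := by
  have h := binom_succ_right z (k - 1)
  rw [sub_add_cancel] at h
  push_cast at h
  rw [binom_pascal]
  linear_combination -h

theorem nat_mul_binomQuot (α : ℝ) {n : ℕ} (hn : 1 ≤ n) :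
    n * binomQuot α n = binom (n + 2 * α) ((n : ℤ) - 1) := by
  have : (n : ℝ) ≠ 0 := by positivity
  rw [binomQuot_eq α n hn]
  field_simp

theorem binomQuot_pos {α : ℝ} (hα : -1 < α) {n : ℕ} (hn : 1 ≤ n) : 0 < binomQuot α n := by
  rw [binomQuot_eq α n hn]
  obtain ⟨m, rfl⟩ : ∃ m, n = m + 1 := ⟨n - 1, by omega⟩
  rw [show ((m + 1 : ℕ) : ℤ) - 1 = m by push_cast; ring]
  have := binom_pos (((m + 1 : ℕ) : ℝ) + 2 * α) m (by push_cast; linarith)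
  positivity

/-- This and `c₀_mul_eq_binomQuot` express B and c₀ as polynomials in λ times Q, up to factors
depending on α alone, the form in which the differential equation produces them. -/
theorem binom_mul_eq_binomQuot (α : ℝ) (n : ℕ) :
    (2 * α + 2) * binom (n + 2 * α + 1) ((n : ℤ) - 1) =
      n * (n + 2 * α + 1) * binomQuot α n := by
  rcases n with _ | m
  · simp [binom_of_neg]
  · have h1 := binom_succ_left (((m + 1 : ℕ) : ℝ) + 2 * α) (((m + 1 : ℕ) : ℤ) - 1)
    rw [← nat_mul_binomQuot α (show 1 ≤ m + 1 by omega)] at h1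
    push_cast at h1 ⊢
    linear_combination h1

theorem binom_nonneg {α : ℝ} (hα : -1 < α) (n : ℕ) :
    0 ≤ binom (n + 2 * α + 1) ((n : ℤ) - 1) := by
  rcases n with _ | m
  · simp [binom_of_neg]
  · rw [show ((m + 1 : ℕ) : ℤ) - 1 = m by push_cast; ring]
    exact (binom_pos _ m (by push_cast; linarith)).le

theorem c₀_mul_eq_binomQuot (α : ℝ) (n : ℕ) :
    (2 * α + 2) * (2 * α + 4) * c₀ α n =
      4 * (n * (n + 2 * α + 1)) * (n * (n + 2 * α + 1) - (2 * α + 2)) * binomQuot α n := by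
  rcases n with _ | m
  · simp [c₀, binom_of_neg]
  · have h1 := binom_succ_left ((m + 1 : ℕ) + 2 * α + 1) (((m + 1 : ℕ) : ℤ) - 2)
    have h2 := binom_succ_right ((m + 1 : ℕ) + 2 * α + 1) (((m + 1 : ℕ) : ℤ) - 2)
    have h3 := binom_mul_eq_binomQuot α (m + 1)
    rw [show ((m + 1 : ℕ) : ℤ) - 2 + 1 = ((m + 1 : ℕ) : ℤ) - 1 by ring] at h2
    rw [c₀, show ((m + 1 : ℕ) : ℝ) + 2 * α + 2 = (m + 1 : ℕ) + 2 * α + 1 + 1 by ring]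
    push_cast at h1 h2 h3 ⊢
    linear_combination 4 * (2 * α + 3) * (2 * α + 2) * h1 - 4 * (2 * α + 2) * (m + 2 * α + 3) * h2
      + 4 * (m + 2 * α + 3) * m * h3

theorem constC0_eq {α : ℝ} (hα : -1 < α) (M : ℝ) (n : ℕ) :
    constC0 α M n = (1 + 2 * M * binom (n + 2 * α + 1) ((n : ℤ) - 1)) ^ 2 := by
  have h := binom_succ_right (n + 2 * α + 1) ((n : ℤ) - 1)
  rw [sub_add_cancel] at h
  push_cast at h
  have h0 : α + 1 ≠ 0 := by linarith
  rw [constC0]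
  field_simp
  linear_combination 2 * M * h

theorem constC1_eq {α : ℝ} (hα : -1 < α) (M : ℝ) (n : ℕ) :
    constC1 α M n = 2 * M * binomQuot α n
      * (1 + 2 * M * binom (n + 2 * α + 1) ((n : ℤ) - 1)) := by
  rcases n with _ | m
  · simp [constC1, binom_of_neg]
  have h := binom_succ_right ((m + 1 : ℕ) + 2 * α + 1) (((m + 1 : ℕ) : ℤ) - 1)
  rw [sub_add_cancel] at h
  rw [constC1, ← nat_mul_binomQuot α (show 1 ≤ m + 1 by omega)]
  push_cast at h ⊢
  have h0 : α + 1 ≠ 0 := by linarith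
  field_simp
  linear_combination M ^ 2 * binomQuot α (m + 1) * h

/-! ### The residue operators on the ultraspherical polynomials -/

theorem kernelOp_jacobi {α : ℝ} (hα : -1 < α) (n : ℕ) : ∃ k : ℝ,
    binomQuot α n = k * ((2 * α + 2) * (2 * α + 3) * (2 * α + 4)) ∧
    kernelOp α 3 (jacobi n α α) =
      C (k * ((2 * α + 3) * (2 * α + 4))) * derivative^[2] (jacobi n α α) ∧
    kernelOp α 4 (jacobi n α α) =
      C (k * (2 * α + 4)) * derivative^[3] (jacobi n α α) ∧
    kernelOp α 5 (jacobi n α α) = C k * derivative^[4] (jacobi n α α) := by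
  have p2 : 2 * α + 2 ≠ 0 := by linarith
  have p3 : 2 * α + 3 ≠ 0 := by linarith
  have p4 : 2 * α + 4 ≠ 0 := by linarith
  set k : ℝ := binomQuot α n / ((2 * α + 2) * (2 * α + 3) * (2 * α + 4)) with hk
  have hQ : binomQuot α n = k * ((2 * α + 2) * (2 * α + 3) * (2 * α + 4)) := by
    rw [hk, div_mul_cancel₀ _ (mul_ne_zero (mul_ne_zero p2 p3) p4)]
  have w2 := kernelOp_two_jacobi hα n
  rw [hQ] at w2
  -- The x-derivative of `kernelOp α j` carries the factor 2α+j, so each step cancels one of the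
  -- three factors put into k.
  have step : ∀ (j : ℕ) (r : ℝ), 2 * α + j ≠ 0 →
      kernelOp α j (jacobi n α α) = C (r * (2 * α + j)) * derivative^[j - 1 + 0] (jacobi n α α) →
      kernelOp α (j + 1 : ℕ) (jacobi n α α) =
        C r * derivative^[j - 1 + 1] (jacobi n α α) := by
    intro j r hj h
    have hd := derivative_kernelOp α j (jacobi n α α)
    rw [h, derivative_C_mul, add_zero, ← Function.iterate_succ_apply' (⇑derivative)] at hd
    have hj' : C (2 * α + (j : ℝ)) ≠ 0 := by simpa only [ne_eq, C_eq_zero] using hj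
    apply mul_left_cancel₀ hj'
    push_cast at hd ⊢
    rw [← hd]
    simp only [C_mul]
    ring
  have w3 := step 2 (k * ((2 * α + 3) * (2 * α + 4))) (by simpa using p2) (by
    simp only [Nat.cast_ofNat, w2]
    congr 2; ring)
  have w4 := step 3 (k * (2 * α + 4)) (by simpa using p3) (by
    rw [w3]; congr 2; push_cast; ring)
  have w5 := step 4 k (by simpa using p4) (by
    rw [w4]; congr 2)
  exact ⟨k, hQ, w3, w4, w5⟩

theorem kernelOp_add_one_three_jacobi {α : ℝ} (hα : -1 < α) (n : ℕ) :
    C (4 * (2 * α + 3)) * (1 - X ^ 2) * kernelOp (α + 1) 3 (jacobi n α α)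
      + C (c₀ α n) * jacobi n α α = C (4 * binomQuot α n) * derivative^[2] (jacobi n α α) := by
  obtain ⟨k, hQ, w3, w4, w5⟩ := kernelOp_jacobi hα n
  have hc : c₀ α n = 4 * k * (2 * α + 3) * (n * (n + 2 * α + 1)) *
      (n * (n + 2 * α + 1) - (2 * α + 2)) := by
    have h := c₀_mul_eq_binomQuot α n
    have p : (2 * α + 2) * (2 * α + 4) ≠ 0 := mul_ne_zero (by linarith) (by linarith)
    apply mul_left_cancel₀ p
    rw [h, hQ]; ring
  have E0 := jacobi_ode n α
  have E1 := congrArg derivative E0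
  have E2 := congrArg derivative E1
  rw [kernelOp_add_one_three, w3, w4, w5, hc, hQ]
  simp only [derivative_add, derivative_sub, derivative_mul, derivative_C, derivative_X,
    derivative_X_pow, derivative_one, derivative_zero, Function.iterate_succ_apply',
    Function.iterate_zero_apply, Nat.cast_ofNat, Nat.add_one_sub_one, pow_one,
    map_ofNat, derivative_ofNat] at E0 E1 E2 ⊢
  simp only [C_mul, C_add, C_sub, C_1, map_ofNat, map_natCast] at E0 E1 E2 ⊢
  linear_combination 4 * C k * (2 * C α + 3) * (-(1 - X ^ 2) * E2 + 2 * (C α + 1) * X * E1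
    + ((n : ℝ[X]) * (n + 2 * C α + 1) - 2 * C α - 2) * E0)

theorem kernelOp_add_one_three_X_mul_derivative_jacobi {α : ℝ} (hα : -1 < α) (n : ℕ) :
    C (4 * (2 * α + 3)) * (1 - X ^ 2) * kernelOp (α + 1) 3 (X * derivative (jacobi n α α))
      + C (c₀ α n) * (X * derivative (jacobi n α α)) =
        C (4 * binom (n + 2 * α + 1) ((n : ℤ) - 1)) * derivative^[2] (jacobi n α α) := by
  have H := congrArg derivative (kernelOp_add_one_three_jacobi hα n)
  have H' := kernelOp_add_one_three α (jacobi n α α)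
  obtain ⟨k, hQ, w3, w4, w5⟩ := kernelOp_jacobi hα n
  have hB : binom (n + 2 * α + 1) ((n : ℤ) - 1) =
      k * (2 * α + 3) * (2 * α + 4) * (n * (n + 2 * α + 1)) := by
    have h := binom_mul_eq_binomQuot α n
    have p : 2 * α + 2 ≠ 0 := by linarith
    apply mul_left_cancel₀ p
    rw [h, hQ]; ring
  have E2 := congrArg derivative (congrArg derivative (jacobi_ode n α))
  rw [w3, w4, w5] at H'
  rw [kernelOp_add_one_three_X_mul_derivative, w5, hB]
  rw [hQ] at H
  generalize kernelOp (α + 1) 3 (jacobi n α α) = S at *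
  simp only [derivative_add, derivative_sub, derivative_mul, derivative_C, derivative_X,
    derivative_X_pow, derivative_one, derivative_zero, Function.iterate_succ_apply',
    Function.iterate_zero_apply, Nat.cast_ofNat, Nat.add_one_sub_one, pow_one,
    map_ofNat, derivative_ofNat] at H H' E2 ⊢
  simp only [C_mul, C_add, C_1, map_ofNat, map_natCast] at H H' E2 ⊢
  linear_combination X * H + 8 * (2 * C α + 3) * H'
    - 4 * C k * (2 * C α + 3) * (2 * C α + 4) * E2

/-- The equation is invariant under reflection and the leading coefficients agree, so the difference
is a solution of degree below n. -/
theorem jacobi_comp_neg_X {α : ℝ} (hα : -1 < α) (n : ℕ) :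
    (jacobi n α α).comp (-X) = C ((-1) ^ n) * jacobi n α α := by
  have E := jacobi_ode n α
  have E' := congrArg (fun p => p.comp (-X)) E
  rw [← sub_eq_zero]
  refine eq_zero_of_ode (γ := α + 1) (n := n) (by linarith) ?_ ?_
  · intro k hk
    have hd := natDegree_jacobi hα n
    have hd' : ((jacobi n α α).comp (-X)).natDegree = n := by rw [natDegree_comp, hd]; simp
    rw [coeff_sub, coeff_C_mul]
    rcases hk.eq_or_lt with rfl | hk
    · have h := comp_neg_X_leadingCoeff_eq (jacobi n α α)
      rw [leadingCoeff, leadingCoeff, hd', hd] at h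
      rw [h, sub_self]
    · rw [coeff_eq_zero_of_natDegree_lt (hd.trans_lt hk),
        coeff_eq_zero_of_natDegree_lt (hd'.trans_lt hk)]
      simp
  · simp only [add_comp, sub_comp, mul_comp, C_comp, X_comp, one_comp, zero_comp, pow_comp] at E'
    simp only [derivative_add, derivative_sub, derivative_mul, derivative_C, derivative_comp,
      derivative_neg, derivative_X]
    rw [show (n : ℝ) + 2 * (α + 1) - 1 = n + 2 * α + 1 by ring]
    simp only [derivative_one, derivative_zero, neg_zero]
    linear_combination E' - C ((-1) ^ n) * E

/-! ### Equivalence of the differential equation and the two systems -/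

theorem tsum_iterate_derivative (A : ℕ → ℝ) {f : ℝ[X]} (x : ℝ) {N : ℕ} (hN : f.natDegree < N) :
    ∑' i, A i * (derivative^[i] f).eval x =
      ∑ i ∈ Finset.range N, A i * (derivative^[i] f).eval x := by
  refine tsum_eq_sum fun i hi => ?_
  rw [iterate_derivative_eq_zero (by simp at hi; omega), eval_zero, mul_zero]

theorem summable_iterate_derivative (A : ℕ → ℝ) (f : ℝ[X]) (x : ℝ) :
    Summable fun i => A i * (derivative^[i] f).eval x := by
  refine summable_of_ne_finset_zero (s := Finset.range (f.natDegree + 1)) fun i hi => ?_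
  rw [iterate_derivative_eq_zero (by simpa using hi), eval_zero, mul_zero]

theorem tsum_iterate_derivative_sub (A : ℕ → ℝ) (r s : ℝ) (f g : ℝ[X]) (x : ℝ) :
    ∑' i, A i * (derivative^[i] (C r * f - C s * g)).eval x =
      r * ∑' i, A i * (derivative^[i] f).eval x - s * ∑' i, A i * (derivative^[i] g).eval x := by
  rw [← tsum_mul_left, ← tsum_mul_left, ← Summable.tsum_sub
    ((summable_iterate_derivative A f x).mul_left r)
    ((summable_iterate_derivative A g x).mul_left s)]
  refine tsum_congr fun i => ?_
  rw [iterate_derivative_sub, iterate_derivative_C_mul, iterate_derivative_C_mul]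
  simp only [eval_sub, eval_mul, eval_C]
  ring

theorem tsum_iterate_derivative_X_mul (A : ℕ → ℝ) (f : ℝ[X]) (x : ℝ) :
    ∑' i : ℕ, (i : ℝ) * A i * (derivative^[i] f).eval x
        + x * ∑' i, A i * (derivative^[i + 1] f).eval x =
      ∑' i, A i * (derivative^[i] (X * derivative f)).eval x := by
  simp only [Function.iterate_succ_apply]
  rw [← tsum_mul_left, ← Summable.tsum_add
    (summable_iterate_derivative (fun i => (i : ℝ) * A i) f x)
    ((summable_iterate_derivative A (derivative f) x).mul_left x)]
  refine tsum_congr fun i => ?_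
  rw [iterate_derivative_X_mul_eq]
  rcases i with _ | i
  · simp; ring
  · rw [Nat.add_sub_cancel, ← Function.iterate_succ_apply (⇑derivative) i]
    simp only [eval_add, eval_mul, eval_X, eval_C]
    ring

theorem solvesSystems_iff (α : ℝ) (a₀ : ℕ → ℝ) (a : ℕ → ℝ → ℝ) :
    SolvesSystems α a₀ a ↔ (∀ i, 1 ≤ i → Continuous (a i)) ∧ ∀ (n : ℕ) (x : ℝ),
      ∑' i, opCoeff (a₀ n) a i x * (derivative^[i] (jacobi n α α)).eval x =
        4 * binomQuot α n * (derivative^[2] (jacobi n α α)).eval x ∧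
      ∑' i, opCoeff (a₀ n) a i x * (derivative^[i] (X * derivative (jacobi n α α))).eval x =
        4 * binom (n + 2 * α + 1) ((n : ℤ) - 1) * (derivative^[2] (jacobi n α α)).eval x := by
  simp only [SolvesSystems, tsum_iterate_derivative_X_mul, forall_and]

theorem satisfiesDE_iff {α : ℝ} (hα : -1 < α) {M : ℝ} (hM : 0 ≤ M) (n : ℕ) (c : ℝ)
    (a : ℕ → ℝ → ℝ) :
    SatisfiesDE α M n c a (genUltraspherical n α M) ↔ ∀ x : ℝ,
      M * ((1 + 2 * M * binom (n + 2 * α + 1) ((n : ℤ) - 1)) *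
          ∑' i, opCoeff c a i x * (derivative^[i] (jacobi n α α)).eval x
        - 2 * M * binomQuot α n *
          ∑' i, opCoeff c a i x * (derivative^[i] (X * derivative (jacobi n α α))).eval x
        - 4 * binomQuot α n * (derivative^[2] (jacobi n α α)).eval x) = 0 := by
  refine forall_congr' fun x => ?_
  have hB : 1 + 2 * M * binom (n + 2 * α + 1) ((n : ℤ) - 1) ≠ 0 := by
    have := binom_nonneg hα n
    positivity
  rw [genUltraspherical, tsum_iterate_derivative_sub, constC0_eq hα, constC1_eq hα]
  have E0 := jacobi_ode n α
  have E1 := congrArg (eval x) (congrArg derivative E0)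
  replace E0 := congrArg (eval x) E0
  generalize ∑' i, opCoeff c a i x * (derivative^[i] (jacobi n α α)).eval x = u
  generalize ∑' i, opCoeff c a i x * (derivative^[i] (X * derivative (jacobi n α α))).eval x = v
  generalize binom (n + 2 * α + 1) ((n : ℤ) - 1) = B at hB ⊢
  generalize binomQuot α n = Q
  simp only [derivative_add, derivative_sub, derivative_mul, derivative_C, derivative_X,
    derivative_X_pow, derivative_one, derivative_zero, Function.iterate_succ_apply',
    Function.iterate_zero_apply, eval_add, eval_sub, eval_mul, eval_pow, eval_X, eval_C,
    eval_one, eval_zero, Nat.cast_ofNat, Nat.add_one_sub_one, pow_one] at E0 E1 ⊢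
  constructor <;> intro h
  · apply mul_left_cancel₀ hB
    linear_combination h - (1 + 2 * M * B) ^ 2 * E0 + 2 * M * Q * (1 + 2 * M * B) * x * E1
  · linear_combination (1 + 2 * M * B) * h + (1 + 2 * M * B) ^ 2 * E0 - 2 * M * Q * (1 + 2 * M * B) * x * E1

theorem isCoefficientFamily_iff_solvesSystems {α : ℝ} (hα : -1 < α) (a₀ : ℕ → ℝ)
    (a : ℕ → ℝ → ℝ) : IsCoefficientFamily α a₀ a ↔ SolvesSystems α a₀ a := by
  rw [solvesSystems_iff]
  refine and_congr_right fun _ => ⟨fun h n x => ?_, fun h M hM n => ?_⟩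
  -- The bracket is affine in M, so M = 1 and M = 2 determine both of its coefficients.
  · have h1 := (satisfiesDE_iff hα zero_le_one n _ a).mp (h 1 zero_le_one n) x
    have h2 := (satisfiesDE_iff hα zero_le_two n _ a).mp (h 2 zero_le_two n) x
    generalize hu : ∑' i, opCoeff (a₀ n) a i x * (derivative^[i] (jacobi n α α)).eval x = u at *
    generalize hv : ∑' i, opCoeff (a₀ n) a i x *
      (derivative^[i] (X * derivative (jacobi n α α))).eval x = v at *
    have hu' : u = 4 * binomQuot α n * (derivative^[2] (jacobi n α α)).eval x := by
      linear_combination 2 * h1 - h2 / 2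
    refine ⟨hu', ?_⟩
    -- For n = 0 the quotient Q cannot always be cancelled (it is 0 at α = -1/2), but both sides
    -- vanish.
    rcases Nat.eq_zero_or_pos n with rfl | hn
    · rw [← hv]
      simp [jacobi_zero]
    · have hQ := (binomQuot_pos hα hn).ne'
      apply mul_left_cancel₀ hQ
      linear_combination -h1 / 2 + (1 / 2 + binom (n + 2 * α + 1) ((n : ℤ) - 1)) * hu'
  · rw [satisfiesDE_iff hα hM]
    intro x
    rw [(h n x).1, (h n x).2]
    ring

/-! ### The explicit solution -/

theorem sum_taylor_neg (f : ℝ[X]) (x : ℝ) {N : ℕ} (hN : f.natDegree < N) :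
    ∑ i ∈ Finset.range N, (-2 * x) ^ i / (i.factorial : ℝ) * (derivative^[i] f).eval x =
      f.eval (-x) := by
  have h := taylor_eval x f (-2 * x)
  rw [show -2 * x + x = -x by ring] at h
  rw [← h, eval_eq_sum_range' (by rwa [natDegree_taylor])]
  refine Finset.sum_congr rfl fun i _ => ?_
  rw [taylor_coeff, ← factorial_smul_hasseDeriv, LinearMap.smul_apply, eval_smul, nsmul_eq_mul]
  have : (i.factorial : ℝ) ≠ 0 := by positivity
  field_simp

theorem c_eq_kernelCoeff (α : ℝ) (i : ℕ) (x : ℝ) :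
    c α i x = 4 * (2 * α + 3) * (1 - x ^ 2) *
      (1 / (i.factorial : ℝ) * (kernelCoeff (α + 1) (i + 1 - 3)).eval x) := by
  rw [c]
  split_ifs with h
  · rw [kernelCoeff_of_neg _ (by omega)]; simp
  · obtain ⟨m, rfl⟩ : ∃ m, i = m + 2 := ⟨i - 2, by omega⟩
    rw [show ((m + 2 : ℕ) : ℤ) + 1 - 3 = m by push_cast; ring, kernelCoeff_natCast,
      Nat.add_sub_cancel, show α - ((m + 2 : ℕ) : ℝ) + 3 = α + 1 - m by push_cast; ring, eval_mul,
      eval_C]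
    ring

/-- The bᵢ are half the Taylor coefficients (-2x)ⁱ/i! of the reflection. Its term i = 0 is absent
from the series, whence the subtracted f(x). -/
theorem tsum_opCoeff_formula (α r₀ t : ℝ) (f : ℝ[X]) (x : ℝ) :
    ∑' i, opCoeff r₀ (fun i x => t * b i x + c α i x) i x * (derivative^[i] f).eval x =
      r₀ * f.eval x + t / 2 * (f.eval (-x) - f.eval x)
        + 4 * (2 * α + 3) * (1 - x ^ 2) * (kernelOp (α + 1) 3 f).eval x := by
  rw [tsum_iterate_derivative _ x (Nat.lt_succ_self _), ← sum_taylor_neg f x (Nat.lt_succ_self _),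
    kernelOp, diffOp, eval_finsetSum]
  simp only [eval_mul, eval_C]
  rw [Finset.mul_sum, Finset.sum_range_succ', Finset.sum_range_succ', Finset.sum_range_succ']
  rw [kernelCoeff_of_neg (α + 1) (show ((0 : ℕ) : ℤ) + 1 - 3 < 0 by norm_num)]
  have key : ∀ i : ℕ, opCoeff r₀ (fun i x => t * b i x + c α i x) (i + 1) x *
      (derivative^[i + 1] f).eval x = t / 2 * ((-2 * x) ^ (i + 1) / ((i + 1).factorial : ℝ) *
      (derivative^[i + 1] f).eval x) + 4 * (2 * α + 3) * (1 - x ^ 2) *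
      (1 / ((i + 1).factorial : ℝ) * (kernelCoeff (α + 1) ((i + 1 : ℕ) + 1 - 3)).eval x *
        (derivative^[i + 1] f).eval x) := by
    intro i
    rw [opCoeff, c_eq_kernelCoeff, b, Nat.add_sub_cancel, neg_mul, ← mul_neg, mul_pow 2,
      pow_succ (2 : ℝ)]
    ring
  simp only [key, Finset.sum_add_distrib, ← Finset.mul_sum]
  simp [opCoeff]
  ring

theorem solvesSystems_formula {α : ℝ} (hα : -1 < α) (t : ℝ) :
    SolvesSystems α (fun n => t * b₀ n + c₀ α n) (fun i x => t * b i x + c α i x) := by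
  rw [solvesSystems_iff]
  refine ⟨fun i _ => ?_, fun n x => ?_⟩
  · have h1 : Continuous (b i) := by unfold b; fun_prop
    have h2 : Continuous (c α i) := by
      unfold c
      split_ifs
      · exact continuous_const
      · fun_prop
    fun_prop
  · have hP := jacobi_comp_neg_X hα n
    have hD := congrArg (eval x) (congrArg derivative hP)
    replace hP := congrArg (eval x) hP
    have h1 := congrArg (eval x) (kernelOp_add_one_three_jacobi hα n)
    have h2 := congrArg (eval x) (kernelOp_add_one_three_X_mul_derivative_jacobi hα n)
    rw [tsum_opCoeff_formula, tsum_opCoeff_formula]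
    simp only [derivative_comp, derivative_neg, derivative_X, derivative_C_mul, eval_comp,
      eval_mul, eval_neg, eval_X, eval_C, eval_one, eval_add, eval_sub, eval_pow]
      at hP hD h1 h2 ⊢
    rw [b₀]
    constructor
    · linear_combination h1 + t / 2 * hP
    · linear_combination h2 + t / 2 * x * hD

/-! ### Uniqueness of the coefficients -/

theorem natCast_mul_sub_X_mul_derivative_jacobi_ne_zero {α : ℝ} (hα : -1 < α) {n : ℕ}
    (hn : 2 ≤ n) : C (n : ℝ) * jacobi n α α - X * derivative (jacobi n α α) ≠ 0 := by
  intro h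
  have E := jacobi_ode n α
  have h1 := congrArg derivative h
  simp only [derivative_sub, derivative_mul, derivative_C, derivative_X, derivative_zero] at h1
  -- If nP = xP', then (n-1)P' = xP'', and the differential equation collapses to P'' = 0.
  have h2 : derivative (derivative (jacobi n α α)) = 0 := by
    simp only [C_mul, C_add, C_1, map_ofNat, map_natCast] at E h h1 ⊢
    linear_combination E - ((n : ℝ[X]) + 2 * C α + 1) * h - X * h1
  have h3 := congrArg (coeff · (n - 2)) h2
  obtain ⟨m, rfl⟩ : ∃ m, n = m + 2 := ⟨n - 2, by omega⟩
  have h4 := (coeff_jacobi_pos hα (m + 2)).ne'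
  simp only [coeff_derivative, coeff_zero, Nat.add_sub_cancel] at h3
  have h5 : ((m + 1 : ℕ) : ℝ) + 1 ≠ 0 := by positivity
  have h6 : (m : ℝ) + 1 ≠ 0 := by positivity
  exact mul_ne_zero (mul_ne_zero h4 h5) h6 h3

theorem eval_iterate_derivative_natDegree_jacobi_ne_zero {α : ℝ} (hα : -1 < α) (n : ℕ) (x : ℝ) :
    (derivative^[n] (jacobi n α α)).eval x ≠ 0 := by
  have h : (derivative^[n] (jacobi n α α)).natDegree ≤ 0 :=
    (natDegree_iterate_derivative _ _).trans (by rw [natDegree_jacobi hα]; simp)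
  rw [eq_C_of_natDegree_le_zero h, eval_C, coeff_iterate_derivative, zero_add, nsmul_eq_mul,
    Nat.descFactorial_self]
  have := coeff_jacobi_pos hα n
  positivity

theorem solvesSystems_unique {α : ℝ} (hα : -1 < α) {a₀ a₀' : ℕ → ℝ} {a a' : ℕ → ℝ → ℝ}
    (h : SolvesSystems α a₀ a) (h' : SolvesSystems α a₀' a') (h1 : a₀ 1 = a₀' 1) (n : ℕ) :
    a₀ n = a₀' n ∧ (1 ≤ n → ∀ x, a n x = a' n x) := by
  rw [solvesSystems_iff] at h h'
  induction n using Nat.strong_induction_on with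
  | _ n ih =>
    have hd := natDegree_jacobi hα n
    have hdX : (X * derivative (jacobi n α α)).natDegree ≤ n := by
      rcases n with _ | m
      · simp [jacobi_zero]
      · refine natDegree_mul_le.trans ?_
        have := natDegree_derivative_le (jacobi (m + 1) α α)
        rw [natDegree_X]; omega
    rcases n with _ | m
    · have e := ((h.2 0 0).1).trans ((h'.2 0 0).1).symm
      rw [tsum_iterate_derivative _ _ (hd.trans_lt zero_lt_one),
        tsum_iterate_derivative _ _ (hd.trans_lt zero_lt_one)] at e
      simpa [jacobi_zero, opCoeff] using e
    have key : ∀ (f : ℝ[X]) (x : ℝ), f.natDegree ≤ m + 1 →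
        ∑' i, opCoeff (a₀ (m + 1)) a i x * (derivative^[i] f).eval x =
          ∑' i, opCoeff (a₀' (m + 1)) a' i x * (derivative^[i] f).eval x →
        (a₀ (m + 1) - a₀' (m + 1)) * f.eval x
          + (a (m + 1) x - a' (m + 1) x) * (derivative^[m + 1] f).eval x = 0 := by
      intro f x hf e
      have split : ∀ g : ℕ → ℝ, ∑ i ∈ Finset.range (m + 1 + 1), g i =
          ∑ i ∈ Finset.range m, g (i + 1) + g 0 + g (m + 1) := fun g => by
        rw [Finset.sum_range_succ, Finset.sum_range_succ']
      rw [tsum_iterate_derivative _ _ (Nat.lt_succ_of_le hf),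
        tsum_iterate_derivative _ _ (Nat.lt_succ_of_le hf), split, split] at e
      have e2 : ∑ i ∈ Finset.range m, opCoeff (a₀ (m + 1)) a (i + 1) x *
            (derivative^[i + 1] f).eval x =
          ∑ i ∈ Finset.range m, opCoeff (a₀' (m + 1)) a' (i + 1) x *
            (derivative^[i + 1] f).eval x := by
        refine Finset.sum_congr rfl fun i hi => ?_
        rw [opCoeff, opCoeff, (ih (i + 1) (by simpa using hi)).2 (by omega) x]
      rw [e2] at e
      simp only [opCoeff, Function.iterate_zero_apply] at e
      linear_combination e
    have k1 : ∀ x, _ := fun x => key (jacobi (m + 1) α α) x hd.le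
      (((h.2 (m + 1) x).1).trans ((h'.2 (m + 1) x).1).symm)
    have k2 : ∀ x, _ := fun x => key (X * derivative (jacobi (m + 1) α α)) x hdX
      (((h.2 (m + 1) x).2).trans ((h'.2 (m + 1) x).2).symm)
    have hz : a₀ (m + 1) - a₀' (m + 1) = 0 := by
      rcases m with _ | m
      · rw [zero_add, h1, sub_self]
      by_contra hne
      -- With n = m+2, the n-th derivative of xP' is n times that of P, so n times the first
      -- equation minus the second eliminates aₙ.
      refine natCast_mul_sub_X_mul_derivative_jacobi_ne_zero hα (show 2 ≤ m + 1 + 1 by omega) ?_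
      refine funext fun x => ?_
      have e1 := k1 x
      have e2 := k2 x
      rw [iterate_derivative_X_mul_eq, ← Function.iterate_succ_apply,
        iterate_derivative_eq_zero (by omega), Nat.add_sub_cancel,
        ← Function.iterate_succ_apply (⇑derivative)] at e2
      apply mul_left_cancel₀ hne
      simp only [eval_add, eval_sub, eval_mul, eval_X, eval_C, eval_zero] at e1 e2 ⊢
      linear_combination ((m + 1 + 1 : ℕ) : ℝ) * e1 - e2
    refine ⟨sub_eq_zero.mp hz, fun _ x => ?_⟩
    have e1 := k1 x
    rw [hz, zero_mul, zero_add] at e1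
    exact sub_eq_zero.mp ((mul_eq_zero.mp e1).resolve_right
      (eval_iterate_derivative_natDegree_jacobi_ne_zero hα (m + 1) x))

theorem solvesSystems_congr {α : ℝ} {a₀ a₀' : ℕ → ℝ} {a a' : ℕ → ℝ → ℝ}
    (h₀ : ∀ n, a₀ n = a₀' n) (h : ∀ i, 1 ≤ i → ∀ x, a i x = a' i x)
    (hs : SolvesSystems α a₀' a') : SolvesSystems α a₀ a := by
  have ho : ∀ n i x, opCoeff (a₀ n) a i x = opCoeff (a₀' n) a' i x := by
    intro n i x
    cases i with
    | zero => exact h₀ n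
    | succ i => exact h (i + 1) (by omega) x
  refine ⟨fun i hi => ?_, ?_, ?_⟩
  · rw [show a i = a' i from _root_.funext (h i hi)]
    exact hs.1 i hi
  · simpa only [ho] using hs.2.1
  · simpa only [ho] using hs.2.2

theorem solvesSystems_iff_formula {α : ℝ} (hα : -1 < α) (a₀ : ℕ → ℝ) (a : ℕ → ℝ → ℝ) :
    SolvesSystems α a₀ a ↔ (∀ n, a₀ n = a₀ 1 * b₀ n + c₀ α n) ∧
      ∀ i, 1 ≤ i → ∀ x, a i x = a₀ 1 * b i x + c α i x := by
  refine ⟨fun h => ?_, fun h => solvesSystems_congr h.1 h.2 (solvesSystems_formula hα (a₀ 1))⟩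
  have hu := solvesSystems_unique hα h (solvesSystems_formula hα (a₀ 1))
    (by norm_num [b₀, c₀, binom_of_neg])
  exact ⟨fun n => (hu n).1, fun i hi => (hu i).2 hi⟩

end GenUltraspherical

end

theorem mainTheorem4 (α : ℝ) (hα : -1 < α) :
    (∀ (a₀ : ℕ → ℝ) (a : ℕ → ℝ → ℝ),
      (GenUltraspherical.IsCoefficientFamily α a₀ a ↔
        (∀ n : ℕ, a₀ n = a₀ 1 * GenUltraspherical.b₀ n + GenUltraspherical.c₀ α n) ∧
        (∀ i : ℕ, 1 ≤ i → ∀ x : ℝ,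
          a i x = a₀ 1 * GenUltraspherical.b i x + GenUltraspherical.c α i x)) ∧
      (GenUltraspherical.SolvesSystems α a₀ a ↔
        (∀ n : ℕ, a₀ n = a₀ 1 * GenUltraspherical.b₀ n + GenUltraspherical.c₀ α n) ∧
        (∀ i : ℕ, 1 ≤ i → ∀ x : ℝ,
          a i x = a₀ 1 * GenUltraspherical.b i x + GenUltraspherical.c α i x))) ∧
    (∀ t : ℝ, ∃ (a₀ : ℕ → ℝ) (a : ℕ → ℝ → ℝ),
      a₀ 1 = t ∧ GenUltraspherical.IsCoefficientFamily α a₀ a) := by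
  refine ⟨fun a₀ a => ⟨?_, GenUltraspherical.solvesSystems_iff_formula hα a₀ a⟩, fun t => ?_⟩
  · rw [GenUltraspherical.isCoefficientFamily_iff_solvesSystems hα]
    exact GenUltraspherical.solvesSystems_iff_formula hα a₀ a
  · refine ⟨_, _, ?_, (GenUltraspherical.isCoefficientFamily_iff_solvesSystems hα _ _).mpr
      (GenUltraspherical.solvesSystems_formula hα t)⟩
    norm_num [GenUltraspherical.b₀, GenUltraspherical.c₀, GenUltraspherical.binom_of_neg]
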